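/- Let $n\ge 1$ and let $\mathcal E_t^\dagger$ ($t=0,1,2,\dots$) be trace-preserving, completely positive linear maps on the complex $n\times n$ matrices. Let $\rho_0\neq\sigma_0$ be density matrices (positive semidefinite, trace one), put $\rho_{t+1}=\mathcal E_t^\dagger(\rho_t)$ and $\sigma_{t+1}=\mathcal E_t^\dagger(\sigma_t)$, and suppose that $\rho_t$ and $\sigma_t$ are invertible for all $t\ge 0$. Let $\mathcal R_{\mathcal E_t,\sigma_t}$ be the reversal map on observables, $$\mathcal R_{\mathcal E_t,\sigma_t}(X)=\sigma_{t+1}^{-1/2}\,\mathcal E_t^\dagger\big(\sigma_t^{1/2}X\sigma_t^{1/2}\big)\,\sigma_{t+1}^{-1/2};$$ if $\mathcal E_t^\dagger(A)=\sum_k M_kAM_k^\dagger$, this is $\sum_k R_kXR_k^\dagger$ with $R_k=\sigma_{t+1}^{-1/2}M_k\sigma_t^{1/2}$. Let $Y_t=\sigma_t^{-1/2}\rho_t\sigma_t^{-1/2}$ and $Z_t=g(Y_t)$ with $g(x)=x\log x$, by functional calculus. Then each $\mathcal R_{\mathcal E_t,\sigma_t}$ is completely positive and identity-preserving, and $\{Y_t\}$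 is space-time harmonic in reverse time with respect to $\{\mathcal R_{\mathcal E_t,\sigma_t}\}$: all $Y_t$ are Hermitian and $$Y_{t+1}=\mathcal R_{\mathcal E_t,\sigma_t}(Y_t)\qquad\text{for all } t\ge 0 .$$ Moreover $\{Z_t\}$ is space-time subharmonic in reverse time with respect to $\{\mathcal R_{\mathcal E_t,\sigma_t}\}$: all $Z_t$ are Hermitian and, in the Loewner order, $$Z_{t+1}\le\mathcal R_{\mathcal E_t,\sigma_t}(Z_t)\qquad\text{for all } t\ge 0 .$$ -/

import Mathlib

open scoped MatrixOrder ComplexOrder Matrix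

noncomputable section

namespace QuantumMarkov

variable {n : Type*} [Fintype n] [DecidableEq n]

/-- Density matrices: positive semidefinite complex matrices of unit trace. -/
def IsDensity (ρ : Matrix n n ℂ) : Prop :=
  ρ.PosSemidef ∧ ρ.trace = 1

/-- The ampliation `Φ ⊗ id` of a linear map `Φ` on `n × n` matrices by the identity on
`k × k` matrices, acting on block matrices: each `n × n` block is sent to its image by `Φ`. -/
def ampliation (Φ : Matrix n n ℂ →ₗ[ℂ] Matrix n n ℂ) (k : ℕ)
    (A : Matrix (n × Fin k) (n × Fin k) ℂ) : Matrix (n × Fin k) (n × Fin k) ℂ :=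
  Matrix.of fun p q => Φ (Matrix.of fun i j => A (i, p.2) (j, q.2)) p.1 q.1

/-- Complete positivity: every ampliation preserves positive semidefiniteness. -/
def IsCompletelyPositive (Φ : Matrix n n ℂ →ₗ[ℂ] Matrix n n ℂ) : Prop :=
  ∀ (k : ℕ) (A : Matrix (n × Fin k) (n × Fin k) ℂ),
    A.PosSemidef → (ampliation Φ k A).PosSemidef

/-- Trace-preserving completely positive linear maps (acting on states). -/
structure IsTPCP (Φ : Matrix n n ℂ →ₗ[ℂ] Matrix n n ℂ) : Prop where
  completelyPositive : IsCompletelyPositive Φ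
  trace_map : ∀ A, (Φ A).trace = A.trace

/-- Identity-preserving quantum operations (acting on observables). -/
structure IsIdentityPreserving (Ψ : Matrix n n ℂ →ₗ[ℂ] Matrix n n ℂ) : Prop where
  completelyPositive : IsCompletelyPositive Ψ
  map_one : Ψ 1 = 1

/-- The quantum Markov evolution `ρ_{t+1} = Φ_t(ρ_t)` started at `ρ₀`. -/
def evolution (Φ : ℕ → Matrix n n ℂ →ₗ[ℂ] Matrix n n ℂ) (ρ₀ : Matrix n n ℂ) :
    ℕ → Matrix n n ℂ
  | 0 => ρ₀
  | t + 1 => Φ t (evolution Φ ρ₀ t)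

/-- The map `A ↦ ∑ j, M j * A * (M j)ᴴ` with Kraus operators `M j`. -/
def krausMap {ι : Type*} [Fintype ι] (M : ι → Matrix n n ℂ) :
    Matrix n n ℂ →ₗ[ℂ] Matrix n n ℂ :=
  ∑ j, LinearMap.mulLeft ℂ (M j) ∘ₗ LinearMap.mulRight ℂ (M j)ᴴ

/-- The reversal map (on observables) of the channel `Φ` (on states) at the state `σ`, written
independently of a Kraus representation of `Φ`:
`X ↦ Φ(σ)^{-1/2} Φ(σ^{1/2} X σ^{1/2}) Φ(σ)^{-1/2}`.
The real powers are those of the functional calculus, with `0 ^ (-1/2) = 0`, so that the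
negative power is that of the Moore-Penrose inverse when `Φ(σ)` is singular. The next two
lemmas identify it with the map with Kraus operators `Φ(σ)^{-1/2} M_j σ^{1/2}`, and with the
adjoint of the dual of `Φ` for the symmetrized inner products of `σ` and `Φ(σ)`. -/
def reversal (Φ : Matrix n n ℂ →ₗ[ℂ] Matrix n n ℂ) (σ : Matrix n n ℂ) :
    Matrix n n ℂ →ₗ[ℂ] Matrix n n ℂ :=
  LinearMap.mulLeft ℂ (Φ σ ^ (-1 / 2 : ℝ)) ∘ₗ LinearMap.mulRight ℂ (Φ σ ^ (-1 / 2 : ℝ)) ∘ₗ Φ ∘ₗ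
    LinearMap.mulLeft ℂ (σ ^ (1 / 2 : ℝ)) ∘ₗ LinearMap.mulRight ℂ (σ ^ (1 / 2 : ℝ))

lemma reversal_krausMap {ι : Type*} [Fintype ι] (M : ι → Matrix n n ℂ) (σ : Matrix n n ℂ) :
    reversal (krausMap M) σ =
      krausMap fun j => krausMap M σ ^ (-1 / 2 : ℝ) * M j * σ ^ (1 / 2 : ℝ) := by
  have h (A : Matrix n n ℂ) (r : ℝ) : (A ^ r)ᴴ = A ^ r :=
    (IsSelfAdjoint.of_nonneg (CFC.rpow_nonneg (a := A) (y := r))).star_eq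
  ext1 X
  simp only [reversal, krausMap, LinearMap.comp_apply, LinearMap.sum_apply,
    LinearMap.mulLeft_apply, LinearMap.mulRight_apply, Matrix.conjTranspose_mul, h,
    Finset.mul_sum, Finset.sum_mul, mul_assoc]

lemma reversal_adjoint {Φ Ψ : Matrix n n ℂ →ₗ[ℂ] Matrix n n ℂ}
    (hΨ : ∀ A X, (X * Φ A).trace = (Ψ X * A).trace) {σ : Matrix n n ℂ}
    (hσ : (Φ σ).PosDef) (X Y : Matrix n n ℂ) :
    (Ψ X * (σ ^ (1 / 2 : ℝ) * Y * σ ^ (1 / 2 : ℝ))).trace =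
      (X * (Φ σ ^ (1 / 2 : ℝ) * reversal Φ σ Y * Φ σ ^ (1 / 2 : ℝ))).trace := by
  have h0 : (0 : Matrix n n ℂ) ≤ Φ σ := hσ.posSemidef.nonneg
  have h1 : Φ σ ^ (1 / 2 : ℝ) * Φ σ ^ (-1 / 2 : ℝ) = 1 := by
    rw [← CFC.rpow_add hσ.isUnit]; norm_num [CFC.rpow_zero _ h0]
  have h2 : Φ σ ^ (-1 / 2 : ℝ) * Φ σ ^ (1 / 2 : ℝ) = 1 := by
    rw [← CFC.rpow_add hσ.isUnit]; norm_num [CFC.rpow_zero _ h0]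
  rw [← hΨ]
  simp only [reversal, LinearMap.comp_apply, LinearMap.mulLeft_apply, LinearMap.mulRight_apply]
  simp only [mul_assoc, h2, mul_one]
  rw [← mul_assoc (Φ σ ^ (1 / 2 : ℝ)), h1, one_mul]

/-- Space-time harmonic in reverse time for the maps `R_t`: Hermitian, `Y_{t+1} = R_t(Y_t)`. -/
def IsReverseHarmonic (R : ℕ → Matrix n n ℂ →ₗ[ℂ] Matrix n n ℂ) (Y : ℕ → Matrix n n ℂ) : Prop :=
  (∀ t, (Y t).IsHermitian) ∧ ∀ t, Y (t + 1) = R t (Y t)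

/-- Space-time subharmonic in reverse time for the maps `R_t`: Hermitian, with
`Z_{t+1} ≤ R_t(Z_t)` in the Loewner order. -/
def IsReverseSubharmonic (R : ℕ → Matrix n n ℂ →ₗ[ℂ] Matrix n n ℂ) (Z : ℕ → Matrix n n ℂ) :
    Prop :=
  (∀ t, (Z t).IsHermitian) ∧ ∀ t, Z (t + 1) ≤ R t (Z t)

/-- The observable `σ^{-1/2} ρ σ^{-1/2}`. -/
def ratio (ρ σ : Matrix n n ℂ) : Matrix n n ℂ :=
  σ ^ (-1 / 2 : ℝ) * ρ * σ ^ (-1 / 2 : ℝ)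

/-- `Y log Y`, by the functional calculus of the Hermitian matrix `Y`. -/
def mulLog (Y : Matrix n n ℂ) : Matrix n n ℂ :=
  cfc (fun x : ℝ => x * Real.log x) Y

end QuantumMarkov

end

namespace QuantumMarkov

open Matrix

variable {n : Type*} [Fintype n] [DecidableEq n]

/-! In `reversal Φ σ (ratio ρ σ)` the inner powers of σ cancel, which leaves `ratio (Φ ρ) (Φ σ)`:
this is harmonicity, and ρ = σ gives `Ψ 1 = 1` for the reversal map Ψ. Subharmonicity is then
Jensen's operator inequality for `x log x`, applied to Ψ at `Y t`.

For Jensen, `x log x` is an integral over s in (0, 1] of an affine function plus a nonnegative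
multiple of `(1 - s + s x)⁻¹`. Affine functions give equality because Ψ is linear and unital; the
inverses are handled by Choi's inequality. No matrix-valued integral is needed: against a fixed
vector, spectral decomposition turns the Jensen gap into a finite sum `∑ f(xᵢ) cᵢ` with nodes and
weights independent of f. -/

/-- Finite spectral decomposition: the functional calculus of a Hermitian matrix is a weighted sum
of fixed matrices. -/
lemma exists_cfc_eq_sum {A : Matrix n n ℂ} (hA : A.IsHermitian) :
    ∃ P : n → Matrix n n ℂ, ∀ f : ℝ → ℝ, cfc f A = ∑ i, (f (hA.eigenvalues i) : ℂ) • P i := by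
  refine ⟨fun i => hA.eigenvectorUnitary * Matrix.single i i (1 : ℂ) *
    star (hA.eigenvectorUnitary : Matrix n n ℂ), fun f => ?_⟩
  have hd (d : n → ℂ) : diagonal d = ∑ i, d i • Matrix.single i i (1 : ℂ) := by
    ext a b
    simp only [Matrix.sum_apply, Matrix.smul_apply, Matrix.single_apply, diagonal_apply]
    rcases eq_or_ne a b with rfl | h
    · simp
    · rw [if_neg h, eq_comm]
      refine Finset.sum_eq_zero fun i _ => ?_
      rw [if_neg fun hi => h (hi.1.symm.trans hi.2), smul_zero]
  rw [hA.cfc_eq, Matrix.IsHermitian.cfc, Unitary.conjStarAlgAut_apply, hd, Finset.mul_sum,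
    Finset.sum_mul]
  simp only [Matrix.mul_smul, Matrix.smul_mul]
  rfl

/-! ### Integral representation of `x log x` -/

/-- `x log x` as an average of rational functions. -/
lemma mul_log_eq_integral {x : ℝ} (hx : 0 < x) :
    x * Real.log x = ∫ s in (0 : ℝ)..1, x * (x - 1) / (1 + s * (x - 1)) := by
  have hpos : ∀ s ∈ Set.uIcc (0 : ℝ) 1, 0 < 1 + s * (x - 1) := by
    intro s hs
    rw [Set.uIcc_of_le zero_le_one] at hs
    nlinarith [hs.1, hs.2, mul_nonneg hs.1 hx.le]
  have hder : ∀ s ∈ Set.uIcc (0 : ℝ) 1,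
      HasDerivAt (fun s : ℝ => x * Real.log (1 + s * (x - 1)))
        (x * (x - 1) / (1 + s * (x - 1))) s := by
    intro s hs
    have h := ((((hasDerivAt_id s).mul_const (x - 1)).const_add 1).log
      (by simpa using (hpos s hs).ne')).const_mul x
    exact h.congr_deriv (by rw [one_mul, mul_div_assoc]; rfl)
  rw [intervalIntegral.integral_eq_sub_of_hasDerivAt hder]
  · simp
  · refine ContinuousOn.intervalIntegrable ?_
    exact ContinuousOn.div (by fun_prop) (by fun_prop) fun s hs => (hpos s hs).ne'

lemma intervalIntegrable_mul_log_integrand {x : ℝ} (hx : 0 < x) :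
    IntervalIntegrable (fun s : ℝ => x * (x - 1) / (1 + s * (x - 1)))
      MeasureTheory.volume 0 1 := by
  refine ContinuousOn.intervalIntegrable ?_
  refine ContinuousOn.div (by fun_prop) (by fun_prop) fun s hs => ?_
  rw [Set.uIcc_of_le zero_le_one] at hs
  have : 0 < 1 + s * (x - 1) := by nlinarith [hs.1, hs.2, mul_nonneg hs.1 hx.le]
  exact this.ne'

/-- Division with remainder in x by `(1 - s) + s x`: only the last term is not affine, and its
coefficient is nonnegative because s ≤ 1. -/
lemma mul_log_integrand_eq {x s : ℝ} (hx : 0 < x) (hs : s ∈ Set.Ioc (0 : ℝ) 1) :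
    x * (x - 1) / (1 + s * (x - 1)) =
      s⁻¹ * x + (s⁻¹ * (1 - s⁻¹) - s⁻¹) + s⁻¹ * (s⁻¹ - 1) * ((1 - s) + s * x)⁻¹ := by
  have h0 := hs.1.ne'
  have : 0 < (1 - s) + s * x := by nlinarith [hs.1, hs.2, mul_pos hs.1 hx]
  have h1 : 1 + s * (x - 1) = (1 - s) + s * x := by ring
  rw [h1]
  have h2 := this.ne'
  generalize hy : (1 - s) + s * x = y at *
  have h3 : x = (y - (1 - s)) / s := by rw [← hy]; field_simp; ring
  rw [h3]
  field_simp
  ring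

/-- A finite combination of point evaluations that annihilates affine functions and is
nonnegative on `x ↦ (1 - s + s x)⁻¹` is nonnegative on `x log x`. -/
lemma sum_mul_log_nonneg {ι : Type*} [Fintype ι] (c x : ι → ℝ) (hx : ∀ i, 0 < x i)
    (h_one : ∑ i, c i = 0) (h_id : ∑ i, x i * c i = 0)
    (h_inv : ∀ s ∈ Set.Ioc (0 : ℝ) 1, 0 ≤ ∑ i, ((1 - s) + s * x i)⁻¹ * c i) :
    0 ≤ ∑ i, x i * Real.log (x i) * c i := by
  have h : ∑ i, x i * Real.log (x i) * c i =
      ∫ s in (0 : ℝ)..1, ∑ i, x i * (x i - 1) / (1 + s * (x i - 1)) * c i := by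
    rw [intervalIntegral.integral_finsetSum
      fun i _ => (intervalIntegrable_mul_log_integrand (hx i)).mul_const _]
    refine Finset.sum_congr rfl fun i _ => ?_
    rw [intervalIntegral.integral_mul_const, ← mul_log_eq_integral (hx i)]
  rw [h, intervalIntegral.integral_of_le zero_le_one]
  refine MeasureTheory.setIntegral_nonneg measurableSet_Ioc fun s hs => ?_
  have : ∑ i, x i * (x i - 1) / (1 + s * (x i - 1)) * c i =
      s⁻¹ * ∑ i, x i * c i + (s⁻¹ * (1 - s⁻¹) - s⁻¹) * ∑ i, c i +
        s⁻¹ * (s⁻¹ - 1) * ∑ i, ((1 - s) + s * x i)⁻¹ * c i := by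
    simp only [Finset.mul_sum, ← Finset.sum_add_distrib]
    refine Finset.sum_congr rfl fun i _ => ?_
    rw [mul_log_integrand_eq (hx i) hs]
    ring
  rw [this, h_id, h_one]
  have h1 : 1 ≤ s⁻¹ := (one_le_inv₀ hs.1).2 hs.2
  have h2 := h_inv s hs
  have h3 : 0 ≤ s⁻¹ * (s⁻¹ - 1) := mul_nonneg (by linarith) (by linarith)
  simpa using mul_nonneg h3 h2

omit [Fintype n] in
lemma posDef_one_sub_smul_add_smul {A : Matrix n n ℂ} (hA : A.PosDef) {s : ℝ}
    (hs : s ∈ Set.Ioc (0 : ℝ) 1) : (((1 - s : ℝ) : ℂ) • 1 + (s : ℂ) • A).PosDef := by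
  refine Matrix.PosDef.posSemidef_add (Matrix.PosSemidef.one.smul ?_) (hA.smul ?_)
  · exact_mod_cast sub_nonneg.2 hs.2
  · exact_mod_cast hs.1

lemma cfc_inv_affine {A : Matrix n n ℂ} (hA : A.PosDef) {s : ℝ} (hs : s ∈ Set.Ioc (0 : ℝ) 1) :
    cfc (fun x : ℝ => ((1 - s) + s * x)⁻¹) A = (((1 - s : ℝ) : ℂ) • 1 + (s : ℂ) • A)⁻¹ := by
  have hsa : IsSelfAdjoint A := hA.isHermitian
  have hc (f : ℝ → ℝ) : ContinuousOn f (spectrum ℝ A) :=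
    (Matrix.finite_real_spectrum (A := A)).continuousOn f
  have h : cfc (fun x : ℝ => (1 - s) + s * x) A = ((1 - s : ℝ) : ℂ) • 1 + (s : ℂ) • A := by
    rw [cfc_add A (fun _ => 1 - s) (fun x => s * x) (hc _) (hc _), cfc_const _ A,
      cfc_const_mul_id s A, Algebra.algebraMap_eq_smul_one]
    simp only [Complex.coe_smul]
  rw [← h]
  refine (Matrix.inv_eq_left_inv ?_).symm
  rw [← cfc_mul _ _ A (hc _) (hc _), ← cfc_one ℝ A]
  refine cfc_congr fun x hx => ?_
  rw [hA.isHermitian.spectrum_real_eq_range_eigenvalues] at hx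
  obtain ⟨i, rfl⟩ := hx
  have := hA.eigenvalues_pos i
  have : 0 < (1 - s) + s * hA.isHermitian.eigenvalues i := by
    nlinarith [hs.1, hs.2, mul_pos hs.1 this]
  simp [this.ne']

/-! ### Choi's inequality and operator Jensen -/

omit [Fintype n] [DecidableEq n] in
/-- A completely positive map preserves positive semidefinite `2 × 2` block matrices. -/
lemma IsCompletelyPositive.fromBlocks {Ψ : Matrix n n ℂ →ₗ[ℂ] Matrix n n ℂ}
    (hΨ : IsCompletelyPositive Ψ) {A B C D : Matrix n n ℂ}
    (h : (Matrix.fromBlocks A B C D).PosSemidef) :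
    (Matrix.fromBlocks (Ψ A) (Ψ B) (Ψ C) (Ψ D)).PosSemidef := by
  -- Reindexing by `e` and `e'` turns the ampliation with k = 2 into the blockwise action of Ψ.
  let e : n × Fin 2 → n ⊕ n := fun p => if p.2 = 0 then Sum.inl p.1 else Sum.inr p.1
  let e' : n ⊕ n → n × Fin 2 := Sum.elim (fun i => (i, 0)) fun i => (i, 1)
  have h2 := (hΨ 2 _ (h.submatrix e)).submatrix e'
  convert h2 using 1
  ext (i | i) (j | j) <;> simp [ampliation, e, e'] <;> rfl

omit [Fintype n] [DecidableEq n] in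
lemma IsCompletelyPositive.map_posSemidef {Ψ : Matrix n n ℂ →ₗ[ℂ] Matrix n n ℂ}
    (hΨ : IsCompletelyPositive Ψ) {A : Matrix n n ℂ} (hA : A.PosSemidef) :
    (Ψ A).PosSemidef := by
  have h := (hΨ 1 _ (hA.submatrix Prod.fst)).submatrix (fun i : n => (i, (0 : Fin 1)))
  exact h

/-- **Choi's inequality** `Ψ(A)⁻¹ ≤ Ψ(A⁻¹)`. -/
lemma IsIdentityPreserving.inv_le_map_inv {Ψ : Matrix n n ℂ →ₗ[ℂ] Matrix n n ℂ}
    (hΨ : IsIdentityPreserving Ψ) {A : Matrix n n ℂ} (hA : A.PosDef) (hB : (Ψ A).PosDef) :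
    (Ψ A)⁻¹ ≤ Ψ A⁻¹ := by
  have hu := hA.isUnit.invertible
  have hu' := hB.isUnit.invertible
  -- The Schur complement of A in this block matrix is zero. After Ψ is applied blockwise, the Schur
  -- complement of `Ψ A` is the desired difference.
  have h : (Matrix.fromBlocks A 1 1 A⁻¹).PosSemidef := by
    have := (hA.fromBlocks₁₁ 1 A⁻¹).2
    simp only [conjTranspose_one, one_mul, mul_one, sub_self] at this
    exact this Matrix.PosSemidef.zero
  have h2 := hΨ.completelyPositive.fromBlocks h
  rw [hΨ.map_one] at h2
  have := (hB.fromBlocks₁₁ 1 (Ψ A⁻¹)).1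
  simp only [conjTranspose_one, one_mul, mul_one] at this
  exact this h2

/-- **Operator Jensen inequality** for `x log x`. -/
theorem IsIdentityPreserving.mulLog_map_le {Ψ : Matrix n n ℂ →ₗ[ℂ] Matrix n n ℂ}
    (hΨ : IsIdentityPreserving Ψ) {A : Matrix n n ℂ} (hA : A.PosDef) (hB : (Ψ A).PosDef) :
    mulLog (Ψ A) ≤ Ψ (mulLog A) := by
  have hherm (f : ℝ → ℝ) (X : Matrix n n ℂ) : (cfc f X).IsHermitian := cfc_predicate f X
  have hΨherm (X : Matrix n n ℂ) (hX : X.IsHermitian) : (Ψ X).IsHermitian := by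
    have hp : (X⁺).PosSemidef := (CFC.posPart_nonneg X).posSemidef
    have hn : (X⁻).PosSemidef := (CFC.negPart_nonneg X).posSemidef
    rw [← CFC.posPart_sub_negPart X hX, map_sub]
    exact (hΨ.completelyPositive.map_posSemidef hp).isHermitian.sub
      (hΨ.completelyPositive.map_posSemidef hn).isHermitian
  rw [Matrix.le_iff]
  refine Matrix.PosSemidef.of_dotProduct_mulVec_nonneg ((hΨherm _ (hherm _ _)).sub (hherm _ _))
    fun v => ?_
  obtain ⟨P, hP⟩ := exists_cfc_eq_sum hA.isHermitian
  obtain ⟨Q, hQ⟩ := exists_cfc_eq_sum hB.isHermitian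
  let q (X : Matrix n n ℂ) : ℝ := (star v ⬝ᵥ X *ᵥ v).re
  -- A signed measure on the eigenvalues of A and of `Ψ A` together; integrating f against it gives
  -- the Jensen gap of f at v.
  let c : n ⊕ n → ℝ := Sum.elim (fun i => q (Ψ (P i))) fun i => -q (Q i)
  let x : n ⊕ n → ℝ := Sum.elim hA.isHermitian.eigenvalues hB.isHermitian.eigenvalues
  have key (f : ℝ → ℝ) : q (Ψ (cfc f A) - cfc f (Ψ A)) = ∑ i, f (x i) * c i := by
    rw [hP, hQ, map_sum]
    simp only [map_smul, q, c, x, Fintype.sum_sum_type, Sum.elim_inl, Sum.elim_inr,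
      Matrix.sub_mulVec, Matrix.sum_mulVec, Matrix.smul_mulVec, dotProduct_sub, dotProduct_sum,
      dotProduct_smul, smul_eq_mul, Complex.sub_re, Complex.re_sum, Complex.re_ofReal_mul,
      mul_neg, Finset.sum_neg_distrib]
    rw [sub_eq_add_neg]
  have hx (i : n ⊕ n) : 0 < x i := by
    rcases i with i | i
    · exact hA.eigenvalues_pos i
    · exact hB.eigenvalues_pos i
  have hre : 0 ≤ q (Ψ (mulLog A) - mulLog (Ψ A)) := by
    rw [mulLog, mulLog, key]
    refine sum_mul_log_nonneg c x hx ?_ ?_ fun s hs => ?_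
    · have := key 1
      rw [Pi.one_def, cfc_const_one ℝ A hA.isHermitian.isSelfAdjoint, cfc_const_one ℝ (Ψ A) hB.isHermitian.isSelfAdjoint,
        hΨ.map_one] at this
      simpa [q] using this.symm
    · have := key id
      rw [cfc_id ℝ A hA.isHermitian.isSelfAdjoint, cfc_id ℝ (Ψ A) hB.isHermitian.isSelfAdjoint] at this
      simpa [q] using this.symm
    · rw [← key fun x => ((1 - s) + s * x)⁻¹, cfc_inv_affine hA hs, cfc_inv_affine hB hs]
      have hm : Ψ (((1 - s : ℝ) : ℂ) • 1 + (s : ℂ) • A) =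
          ((1 - s : ℝ) : ℂ) • 1 + (s : ℂ) • Ψ A := by simp [hΨ.map_one]
      have := hΨ.inv_le_map_inv (posDef_one_sub_smul_add_smul hA hs)
        (hm ▸ posDef_one_sub_smul_add_smul hB hs)
      rw [hm] at this
      exact (Complex.le_def.1 ((Matrix.le_iff.1 this).dotProduct_mulVec_nonneg v)).1
  -- The order on ℂ also requires a zero imaginary part, which holds because the difference is
  -- Hermitian.
  refine Complex.le_def.2 ⟨hre, ?_⟩
  have := ((hΨherm _ (hherm (fun x : ℝ => x * Real.log x) A)).sub
    (hherm (fun x : ℝ => x * Real.log x) (Ψ A))).im_star_dotProduct_mulVec_self v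
  exact this.symm

/-! ### The reversal map -/

lemma rpow_isHermitian (A : Matrix n n ℂ) (r : ℝ) : (A ^ r).IsHermitian :=
  IsSelfAdjoint.of_nonneg (CFC.rpow_nonneg (a := A) (y := r))

/-- Conjugating a completely positive map on both sides yields a completely positive map. -/
lemma IsCompletelyPositive.reversal {Φ : Matrix n n ℂ →ₗ[ℂ] Matrix n n ℂ}
    (hΦ : IsCompletelyPositive Φ) (σ : Matrix n n ℂ) : IsCompletelyPositive (reversal Φ σ) := by
  intro k A hA
  -- With S = σ^{1/2} ⊗ 1 and T = Φ(σ)^{-1/2} ⊗ 1, the ampliated reversal is A ↦ T (Φ ⊗ id)(S A S)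
  -- T, a composition of positive maps.
  let S : Matrix (n × Fin k) (n × Fin k) ℂ :=
    Matrix.kroneckerMap (· * ·) (σ ^ (1 / 2 : ℝ)) (1 : Matrix (Fin k) (Fin k) ℂ)
  let T : Matrix (n × Fin k) (n × Fin k) ℂ :=
    Matrix.kroneckerMap (· * ·) (Φ σ ^ (-1 / 2 : ℝ)) (1 : Matrix (Fin k) (Fin k) ℂ)
  have hS : Sᴴ = S := by
    simp only [S, Matrix.conjTranspose_kronecker, (rpow_isHermitian _ _).eq, conjTranspose_one]
  have hT : Tᴴ = T := by
    simp only [T, Matrix.conjTranspose_kronecker, (rpow_isHermitian _ _).eq, conjTranspose_one]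
  have block (M : Matrix n n ℂ) (X : Matrix (n × Fin k) (n × Fin k) ℂ) (a b : Fin k) :
      (Matrix.of fun i j => (Matrix.kroneckerMap (· * ·) M (1 : Matrix (Fin k) (Fin k) ℂ) * X *
        Matrix.kroneckerMap (· * ·) M (1 : Matrix (Fin k) (Fin k) ℂ)) (i, a) (j, b)) =
      M * (Matrix.of fun i j => X (i, a) (j, b)) * M := by
    ext i j
    simp [Matrix.mul_apply, Fintype.sum_prod_type, Matrix.one_apply]
  have h := (hΦ k _ (hA.mul_mul_conjTranspose_same S)).mul_mul_conjTranspose_same T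
  rw [hS, hT] at h
  convert h using 1
  ext ⟨i, a⟩ ⟨j, b⟩
  have h1 := congrFun (congrFun (block (Φ σ ^ (-1 / 2 : ℝ)) (ampliation Φ k (S * A * S)) a b) i) j
  have h2 := block (σ ^ (1 / 2 : ℝ)) A a b
  simp only [Matrix.of_apply] at h1
  refine Eq.trans ?_ h1.symm
  have h3 : (Matrix.of fun i j => ampliation Φ k (S * A * S) (i, a) (j, b)) =
      Φ (σ ^ (1 / 2 : ℝ) * (Matrix.of fun i j => A (i, a) (j, b)) * σ ^ (1 / 2 : ℝ)) := by
    rw [← h2]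
    rfl
  rw [h3]
  simp only [ampliation, QuantumMarkov.reversal, LinearMap.comp_apply, LinearMap.mulLeft_apply,
    LinearMap.mulRight_apply, Matrix.of_apply, mul_assoc]

lemma rpow_mul_rpow_of_add_eq_zero {A : Matrix n n ℂ} (hA : A.PosDef) {r s : ℝ}
    (h : r + s = 0) : A ^ r * A ^ s = 1 := by
  rw [← CFC.rpow_add hA.isUnit, h, CFC.rpow_zero _ hA.posSemidef.nonneg]

lemma reversal_ratio (Φ : Matrix n n ℂ →ₗ[ℂ] Matrix n n ℂ) (ρ : Matrix n n ℂ)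
    {σ : Matrix n n ℂ} (hσ : σ.PosDef) :
    reversal Φ σ (ratio ρ σ) = ratio (Φ ρ) (Φ σ) := by
  have h1 : σ ^ (1 / 2 : ℝ) * σ ^ (-1 / 2 : ℝ) = 1 := rpow_mul_rpow_of_add_eq_zero hσ (by norm_num)
  have h2 : σ ^ (-1 / 2 : ℝ) * σ ^ (1 / 2 : ℝ) = 1 := rpow_mul_rpow_of_add_eq_zero hσ (by norm_num)
  have h : σ ^ (1 / 2 : ℝ) * (ratio ρ σ * σ ^ (1 / 2 : ℝ)) = ρ := by
    rw [ratio, mul_assoc, mul_assoc, h2, mul_one, ← mul_assoc, h1, one_mul]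
  simp only [reversal, LinearMap.comp_apply, LinearMap.mulLeft_apply, LinearMap.mulRight_apply, h]
  rw [ratio, mul_assoc]

lemma ratio_self {σ : Matrix n n ℂ} (hσ : σ.PosDef) : ratio σ σ = 1 := by
  have h : σ ^ (1 : ℝ) = σ := CFC.rpow_one σ hσ.posSemidef.nonneg
  have h1 : σ ^ (-1 / 2 : ℝ) * σ ^ (1 : ℝ) * σ ^ (-1 / 2 : ℝ) = 1 := by
    rw [← CFC.rpow_add hσ.isUnit]
    exact rpow_mul_rpow_of_add_eq_zero hσ (by norm_num)
  rwa [h] at h1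

lemma ratio_posDef {ρ σ : Matrix n n ℂ} (hρ : ρ.PosDef) (hσ : σ.PosDef) :
    (ratio ρ σ).PosDef := by
  have hu : IsUnit (σ ^ (-1 / 2 : ℝ)) :=
    IsUnit.of_mul_eq_one _ (rpow_mul_rpow_of_add_eq_zero hσ (s := 1 / 2) (by norm_num))
  have h := (Matrix.IsUnit.posDef_star_right_conjugate_iff hu (x := ρ)).2 hρ
  rwa [star_eq_conjTranspose, (rpow_isHermitian _ _).eq] at h

lemma reversal_isIdentityPreserving {Φ : Matrix n n ℂ →ₗ[ℂ] Matrix n n ℂ}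
    (hΦ : IsCompletelyPositive Φ) {σ : Matrix n n ℂ} (hσ : σ.PosDef) (hΦσ : (Φ σ).PosDef) :
    IsIdentityPreserving (reversal Φ σ) where
  completelyPositive := hΦ.reversal σ
  map_one := by
    -- The identity is the ratio of σ to itself, so unitality is the case ρ = σ of `reversal_ratio`.
    rw [← ratio_self hσ, reversal_ratio Φ σ hσ, ratio_self hΦσ, ratio_self hσ]

omit [Fintype n] [DecidableEq n] in
lemma evolution_posSemidef {Φ : ℕ → Matrix n n ℂ →ₗ[ℂ] Matrix n n ℂ}
    (hΦ : ∀ t, IsCompletelyPositive (Φ t)) {ρ₀ : Matrix n n ℂ} (hρ₀ : ρ₀.PosSemidef) (t : ℕ) :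
    (evolution Φ ρ₀ t).PosSemidef := by
  induction t with
  | zero => exact hρ₀
  | succ t ih => exact (hΦ t).map_posSemidef ih

end QuantumMarkov

theorem mainTheorem3 {n : Type*} [Fintype n] [DecidableEq n]
    (Φ : ℕ → Matrix n n ℂ →ₗ[ℂ] Matrix n n ℂ) (hΦ : ∀ t, QuantumMarkov.IsTPCP (Φ t))
    (ρ₀ σ₀ : Matrix n n ℂ)
    (hρ₀ : QuantumMarkov.IsDensity ρ₀) (hσ₀ : QuantumMarkov.IsDensity σ₀) (hne : ρ₀ ≠ σ₀)
    (hρ : ∀ t, IsUnit (QuantumMarkov.evolution Φ ρ₀ t))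
    (hσ : ∀ t, IsUnit (QuantumMarkov.evolution Φ σ₀ t)) :
    let R : ℕ → Matrix n n ℂ →ₗ[ℂ] Matrix n n ℂ :=
      fun t => QuantumMarkov.reversal (Φ t) (QuantumMarkov.evolution Φ σ₀ t)
    let Y : ℕ → Matrix n n ℂ := fun t =>
      QuantumMarkov.ratio (QuantumMarkov.evolution Φ ρ₀ t) (QuantumMarkov.evolution Φ σ₀ t)
    let Z : ℕ → Matrix n n ℂ := fun t => QuantumMarkov.mulLog (Y t)
    (∀ t, QuantumMarkov.IsIdentityPreserving (R t)) ∧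
      QuantumMarkov.IsReverseHarmonic R Y ∧
      QuantumMarkov.IsReverseSubharmonic R Z := by
  intro R Y Z
  have hcp := fun t => (hΦ t).completelyPositive
  have hρ' (t : ℕ) : (QuantumMarkov.evolution Φ ρ₀ t).PosDef :=
    (QuantumMarkov.evolution_posSemidef hcp hρ₀.1 t).posDef_iff_isUnit.2 (hρ t)
  have hσ' (t : ℕ) : (QuantumMarkov.evolution Φ σ₀ t).PosDef :=
    (QuantumMarkov.evolution_posSemidef hcp hσ₀.1 t).posDef_iff_isUnit.2 (hσ t)
  have hY (t : ℕ) : (Y t).PosDef := QuantumMarkov.ratio_posDef (hρ' t) (hσ' t)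
  have hR (t : ℕ) : QuantumMarkov.IsIdentityPreserving (R t) :=
    QuantumMarkov.reversal_isIdentityPreserving (hcp t) (hσ' t) (hσ' (t + 1))
  have hYR (t : ℕ) : Y (t + 1) = R t (Y t) :=
    (QuantumMarkov.reversal_ratio (Φ t) _ (hσ' t)).symm
  refine ⟨hR, ⟨fun t => (hY t).isHermitian, hYR⟩, fun t => cfc_predicate _ (Y t), fun t => ?_⟩
  -- Harmonicity enters twice: it makes `R t (Y t)` positive definite, and it identifies the left
  -- side of Jensen with `Z (t + 1)`.
  have h := (hR t).mulLog_map_le (hY t) (hYR t ▸ hY (t + 1))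
  rwa [← hYR t] at h
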